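/- Let $\xi_0,\xi_1,\xi_2,\dots$ be independent identically distributed real- or complex-valued random variables on a probability space, with $\mathbb P(\xi_0=0)<1$ and $\mathbb E\log(1+|\xi_0|)<\infty$. For $n\ge 1$ let $G_n(z)=\xi_0+\xi_1z+\dots+\xi_nz^n$, and for measurable $A\subset\mathbb C$ let $N_n(A)$ be the number of complex zeros of $G_n$ in $A$, counted with multiplicity (with $N_n=0$ if $G_n$ is the zero polynomial). Then, with probability one, the measures $N_n/n$ converge weakly as $n\to\infty$ to the uniform distribution on the unit circle $\Gamma=\{z\in\mathbb C:|z|=1\}$, that is, to the probability measure $N(\cdot)=\mu(\cdot\cap\Gamma)/(2\pi)$, where $\mu$ is arc length (Lebesgue measure) on $\Gamma$. -/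

import Mathlib

open MeasureTheory ProbabilityTheory Filter Topology
open scoped NNReal ENNReal

noncomputable section

/-- The polynomial `a₀ + a₁ z + ⋯ + aₙ zⁿ`. -/
def coeffPoly (a : ℕ → ℂ) (n : ℕ) : Polynomial ℂ :=
  ∑ k ∈ Finset.range (n + 1), Polynomial.monomial k (a k)

/-- The counting measure of the zeros of `p`, with multiplicity: a unit mass is put at each entry
of the multiset of complex roots of `p` (which is empty for `p = 0`). -/
def zeroCountingMeasure (p : Polynomial ℂ) : FiniteMeasure ℂ :=
  (p.roots.map fun z => (diracProba z).toFiniteMeasure).sum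

/-- The empirical distribution `Nₙ / n` of the zeros of `a₀ + a₁ z + ⋯ + aₙ zⁿ`. -/
def empiricalZeroMeasure (a : ℕ → ℂ) (n : ℕ) : FiniteMeasure ℂ :=
  (n : ℝ≥0)⁻¹ • zeroCountingMeasure (coeffPoly a n)

/-- Arc length on the unit circle, as a measure on `ℂ`: the image of Lebesgue measure on `(0, 2π]`
under the arc-length parametrization `θ ↦ exp (i θ)`. -/
def circleArcLength : Measure ℂ :=
  (volume.restrict (Set.Ioc 0 (2 * Real.pi))).map
    fun θ : ℝ => Complex.exp ((θ : ℂ) * Complex.I)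

/-- The uniform distribution on the unit circle: arc length divided by `2π`. -/
def circleUniform : ProbabilityMeasure ℂ :=
  ⟨(ENNReal.ofReal (2 * Real.pi))⁻¹ • circleArcLength, ⟨by
    have hm : Measurable fun θ : ℝ => Complex.exp ((θ : ℂ) * Complex.I) := by fun_prop
    have hpos : ENNReal.ofReal (2 * Real.pi) ≠ 0 := by
      simpa using Real.pi_pos
    rw [Measure.smul_apply, circleArcLength, Measure.map_apply hm MeasurableSet.univ,
      Set.preimage_univ, Measure.restrict_apply_univ, Real.volume_Ioc, sub_zero, smul_eq_mul]
    exact ENNReal.inv_mul_cancel hpos ENNReal.ofReal_ne_top⟩⟩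

end

/-!
The zeros of `Gₙ` are controlled by `log |Gₙ|` on the unit circle. The proof separates a
deterministic statement about coefficient sequences (`tendsto_empiricalZeroMeasure`) from a short
probabilistic verification of its hypotheses.

**Deterministic part.** Let `a` be a sequence with `log (1 + |aₙ|) = o(n)`, and suppose that for
some `δ > 0` there are indices `k n ≤ n`, `k n ∼ n`, with `|a (k n)| ≥ δ`. Let `p` be the `n`-th
partial sum. Then the mean of `|log |p||` over the unit circle is `o(n)`: from above
`|p| ≤ ∑ |aⱼ|`, and from below the mean of `log |p|`, the logarithmic Mahler measure, is bounded by
Mahler's inequality `|a_k| ≤ (deg p).choose k * M(p)` at `k = k n`, where the binomial coefficient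
is subexponential because `deg p - k n = o(n)`.

* *Arguments.* Let `φ = conjFold` be complex conjugation on the closed disk and inversion outside.
  For `|w| = 1` one has `|w - z| = max 1 |z| * |1 - φ(z) w|`, and the Fourier coefficient of order
  `m ≥ 1` of `log |1 - u w|` is `-uᵐ / (2m)` for `|u| ≤ 1`. Hence `∑ φ(z)ᵐ` over the roots of `p` is
  `-2m` times a Fourier coefficient of `log |p|` (`circleAverage_log_norm_eval_mul`), so it is
  `o(n)`.
* *Moduli.* Mahler's inequality for the polynomial with roots scaled by `R⁻¹` or `R`, compared with
  the Mahler measure of `p` itself, shows that only `o(n)` roots satisfy `|z| ≥ R` (using the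
  coefficient of index `k n`) or `|z| ≤ R⁻¹` (using a fixed nonzero coefficient). The leading
  coefficient never enters, which matters because it may be zero or arbitrarily small.

On the unit circle `φᵐ` is `w⁻ᵐ`, so density of trigonometric polynomials together with the
concentration of the roots near the circle yields weak convergence (`tendsto_multisetAverage`).

**Probabilistic part.** The strong law of large numbers for `log (1 + |ξₖ|)` gives
`log (1 + |ξₙ|) = o(n)` almost surely. Applied to the indicators of `|ξₖ| ≥ δ`, with `δ` such that
this event has positive probability, it shows that these indices have positive density, so that the
last one up to `n` is asymptotic to `n` (`tendsto_findGreatest_div`).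
-/

/-! ### Fourier coefficients of `log |1 - u w|` on the unit circle -/

section LogFourier

open Complex ComplexConjugate

theorem circleAverage_zpow (j : ℤ) :
    Real.circleAverage (fun w : ℂ => w ^ j) 0 1 = if j = 0 then 1 else 0 := by
  split_ifs with h
  · subst h
    simpa using Real.circleAverage_const (1 : ℂ) 0 1
  · have hI : ((j : ℂ) * I) ≠ 0 := by simp [h]
    have : ∀ θ : ℝ, circleMap 0 1 θ ^ j = Complex.exp (j * I * θ) := by
      intro θ
      rw [circleMap_zero, ofReal_one, one_mul, ← Complex.exp_int_mul]
      ring_nf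
    simp only [Real.circleAverage_def, this]
    have h2 : Complex.exp (j * I * ((2 * Real.pi : ℝ) : ℂ)) = 1 := by
      rw [← Complex.exp_int_mul_two_pi_mul_I j]
      push_cast
      ring_nf
    rw [integral_exp_mul_complex hI, h2]
    simp

/-- The Fourier coefficient of order `m ≥ 1` of `θ ↦ log |1 - u exp (iθ)|`. -/
theorem circleAverage_log_norm_one_sub_mul_of_lt {u : ℂ} (hu : ‖u‖ < 1) {m : ℕ} (hm : m ≠ 0) :
    Real.circleAverage (fun w : ℂ => (Real.log ‖1 - u * w‖ : ℂ) * w⁻¹ ^ m) 0 1 =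
      -u ^ m / (2 * m) := by
  -- `log ‖1 - u w‖` is the real part of a logarithm, expanded in powers of `w` and `conj w = w⁻¹`
  have key : ∀ w : ℂ, ‖w‖ = 1 →
      HasSum (fun k : ℕ => -((u ^ k / k) * w ^ ((k : ℤ) - m) +
        (conj u ^ k / k) * w ^ (-(k : ℤ) - m)) / 2) ((Real.log ‖1 - u * w‖ : ℂ) * w⁻¹ ^ m) := by
    intro w hw
    have hw0 : w ≠ 0 := by rintro rfl; simp at hw
    have h1 := Complex.hasSum_taylorSeries_neg_log (z := u * w) (by simpa [hw] using hu)
    have h2 := h1.mapL (Complex.conjCLE : ℂ →L[ℝ] ℂ)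
    have h3 := ((h1.add h2).mul_right (-(w⁻¹ ^ m) / 2))
    have hcw : conj w = w⁻¹ := by rw [Complex.inv_def, Complex.normSq_eq_norm_sq, hw]; simp
    convert! h3 using 1
    · ext k
      simp only [ContinuousLinearEquiv.coe_coe, Complex.conjCLE_apply, map_div₀, map_pow, map_mul,
        Complex.conj_natCast, hcw, mul_pow]
      rw [zpow_sub₀ hw0, zpow_sub₀ hw0, zpow_neg]
      simp only [zpow_natCast, inv_pow]
      field_simp
    · have : (Real.log ‖1 - u * w‖ : ℂ) =
          (Complex.log (1 - u * w) + conj (Complex.log (1 - u * w))) / 2 := by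
        rw [Complex.add_conj, Complex.log_re]
        push_cast
        ring
      rw [this]
      simp
      ring
  have hs : HasSum (fun k : ℕ => ∫ θ in (0 : ℝ)..(2 * Real.pi),
      -((u ^ k / k) * circleMap 0 1 θ ^ ((k : ℤ) - m) +
        (conj u ^ k / k) * circleMap 0 1 θ ^ (-(k : ℤ) - m)) / 2)
      (∫ θ in (0 : ℝ)..(2 * Real.pi),
        (Real.log ‖1 - u * circleMap 0 1 θ‖ : ℂ) * (circleMap 0 1 θ)⁻¹ ^ m) := by
    have hcont : ∀ j : ℤ, Continuous fun θ : ℝ => circleMap 0 1 θ ^ j := fun j =>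
      (continuous_circleMap 0 1).zpow₀ j fun θ => Or.inl (circleMap_ne_center one_ne_zero)
    refine intervalIntegral.hasSum_integral_of_dominated_convergence
      (fun k _ => ‖u‖ ^ k) (fun k => ?_) (fun k => ?_) ?_ ?_ ?_
    · apply Continuous.aestronglyMeasurable
      have := hcont (k - m)
      have := hcont (-k - m)
      fun_prop
    · refine Eventually.of_forall fun θ _ => ?_
      have hn : ∀ j : ℤ, ‖circleMap 0 1 θ ^ j‖ = 1 := by simp
      have hk : ‖u‖ ^ k / (k : ℝ) ≤ ‖u‖ ^ k := by
        rcases k.eq_zero_or_pos with rfl | hk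
        · simp
        · exact div_le_self (by positivity) (by exact_mod_cast hk)
      rw [norm_div, norm_neg, RCLike.norm_ofNat, div_le_iff₀ two_pos]
      refine (norm_add_le _ _).trans ?_
      simp only [norm_mul, hn, norm_div, norm_pow, RCLike.norm_conj, Complex.norm_natCast]
      linarith
    · exact Eventually.of_forall fun θ _ => summable_geometric_of_lt_one (norm_nonneg _) hu
    · exact intervalIntegrable_const
    · exact Eventually.of_forall fun θ _ => key _ (by simp)
  have hs2 := hs.const_smul ((2 * Real.pi)⁻¹ : ℝ)
  have hint : ∀ (c : ℂ) (j : ℤ), CircleIntegrable (fun w => c • w ^ j) 0 1 := fun c j =>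
    (((continuous_circleMap 0 1).zpow₀ j
      fun θ => Or.inl (circleMap_ne_center one_ne_zero)).const_smul c).intervalIntegrable _ _
  have hterm : ∀ k : ℕ, ((2 * Real.pi)⁻¹ : ℝ) • (∫ θ in (0 : ℝ)..(2 * Real.pi),
      -((u ^ k / k) * circleMap 0 1 θ ^ ((k : ℤ) - m) +
        (conj u ^ k / k) * circleMap 0 1 θ ^ (-(k : ℤ) - m)) / 2) =
      if k = m then -u ^ m / (2 * m) else 0 := by
    intro k
    have e : (fun w : ℂ => -((u ^ k / k) * w ^ ((k : ℤ) - m) +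
        (conj u ^ k / k) * w ^ (-(k : ℤ) - m)) / 2) =
        fun w => (-(u ^ k / k) / 2) • w ^ ((k : ℤ) - m) +
          (-(conj u ^ k / k) / 2) • w ^ (-(k : ℤ) - m) := by
      ext w; simp only [smul_eq_mul]; ring
    have h := congrArg (fun f : ℂ → ℂ => Real.circleAverage f 0 1) e
    beta_reduce at h
    rw [Real.circleAverage_fun_add (hint _ _) (hint _ _),
      Real.circleAverage_fun_smul, Real.circleAverage_fun_smul, circleAverage_zpow,
      circleAverage_zpow, if_neg (by omega : ¬ (-(k : ℤ) - m = 0))] at h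
    rw [Real.circleAverage_def] at h
    rw [h]
    by_cases hk : k = m
    · subst hk
      simp
      ring
    · rw [if_neg hk, if_neg (by omega)]
      simp
  simp only [hterm] at hs2
  exact hs2.unique (hasSum_ite_eq m _)

theorem circleIntegrable_log_norm_one_sub_mul (u : ℂ) :
    CircleIntegrable (fun w : ℂ => Real.log ‖1 - u * w‖) 0 1 := by
  apply MeromorphicOn.circleIntegrable_log_norm
  intro z _
  exact AnalyticAt.meromorphicAt (by fun_prop)

/-- The Fourier coefficient for all `‖u‖ ≤ 1`: the boundary case `‖u‖ = 1` follows from `‖u‖ < 1` by dominated convergence. -/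
theorem circleAverage_log_norm_one_sub_mul {u : ℂ} (hu : ‖u‖ ≤ 1) {m : ℕ} (hm : m ≠ 0) :
    Real.circleAverage (fun w : ℂ => (Real.log ‖1 - u * w‖ : ℂ) * w⁻¹ ^ m) 0 1 =
      -u ^ m / (2 * m) := by
  rcases hu.lt_or_eq with hu1 | hu1
  · exact circleAverage_log_norm_one_sub_mul_of_lt hu1 hm
  have hu0 : u ≠ 0 := by rintro rfl; simp at hu1
  have hs : ∀ᶠ s : ℝ in 𝓝[<] 1, 0 < s ∧ s < 1 :=
    Ioo_mem_nhdsLT zero_lt_one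
  have hlim : Tendsto (fun s : ℝ => ∫ θ in (0 : ℝ)..(2 * Real.pi),
      (Real.log ‖1 - (s * u) * circleMap 0 1 θ‖ : ℂ) * (circleMap 0 1 θ)⁻¹ ^ m) (𝓝[<] 1)
      (𝓝 (∫ θ in (0 : ℝ)..(2 * Real.pi),
      (Real.log ‖1 - u * circleMap 0 1 θ‖ : ℂ) * (circleMap 0 1 θ)⁻¹ ^ m)) := by
    have hne : ∀ᵐ θ : ℝ, circleMap 0 1 θ ≠ u⁻¹ := by
      have : ({u⁻¹} : Set ℂ).Countable := Set.countable_singleton _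
      exact (this.preimage_circleMap 0 one_ne_zero).ae_notMem volume
    refine intervalIntegral.tendsto_integral_filter_of_dominated_convergence
      (fun θ => |Real.log ‖1 - u * circleMap 0 1 θ‖| + Real.log 2) ?_ ?_ ?_ ?_
    · refine Eventually.of_forall fun s => Measurable.aestronglyMeasurable ?_
      have : Measurable (circleMap 0 1) := (continuous_circleMap 0 1).measurable
      fun_prop
    · filter_upwards [hs] with s hs
      filter_upwards [hne] with θ hθ _
      set w := circleMap 0 1 θ with hw
      have hw1 : ‖w‖ = 1 := by simp [hw]
      have hy : 0 < ‖1 - u * w‖ := by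
        rw [norm_pos_iff, sub_ne_zero]
        intro h
        exact hθ (eq_inv_of_mul_eq_one_right h.symm)
      have hsu : ‖(s : ℂ) * u * w‖ = s := by
        rw [norm_mul, norm_mul, hu1, hw1, Complex.norm_real, Real.norm_of_nonneg hs.1.le]; simp
      have h1 : 1 - s ≤ ‖1 - s * u * w‖ := by
        have := norm_sub_norm_le (1 : ℂ) (s * u * w)
        rwa [hsu, norm_one] at this
      -- the distance from `1` to the radius through `u * w` is at least half of `‖1 - u * w‖`
      have h2 : ‖1 - u * w‖ ≤ 2 * ‖1 - s * u * w‖ := by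
        have e : (1 : ℂ) - u * w = (1 - s * u * w) - ((1 - s : ℝ) : ℂ) * (u * w) := by
          push_cast; ring
        have h3 : ‖((1 - s : ℝ) : ℂ) * (u * w)‖ = 1 - s := by
          rw [norm_mul, norm_mul, hu1, hw1, Complex.norm_real,
            Real.norm_of_nonneg (by linarith [hs.2])]
          simp
        rw [e]
        refine (norm_sub_le _ _).trans ?_
        rw [h3]
        linarith
      have hx : 0 < ‖1 - s * u * w‖ := by linarith
      have h4 : ‖1 - s * u * w‖ ≤ 2 := by
        refine (norm_sub_le _ _).trans ?_
        rw [hsu, norm_one]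
        linarith [hs.2]
      have h5 : ‖(w⁻¹) ^ m‖ = 1 := by simp [hw1]
      rw [norm_mul, h5, mul_one, Complex.norm_real, Real.norm_eq_abs, abs_le]
      have h6 := Real.log_le_log hx h4
      have h7 := Real.log_le_log hy h2
      rw [Real.log_mul two_ne_zero hx.ne'] at h7
      have h8 := neg_abs_le (Real.log ‖1 - u * w‖)
      have h9 := abs_nonneg (Real.log ‖1 - u * w‖)
      constructor <;> linarith
    · exact IntervalIntegrable.add (circleIntegrable_log_norm_one_sub_mul u).abs
        intervalIntegrable_const
    · filter_upwards [hne] with θ hθ _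
      have hy : ‖1 - u * circleMap 0 1 θ‖ ≠ 0 := by
        rw [norm_ne_zero_iff, sub_ne_zero]
        intro h
        exact hθ (eq_inv_of_mul_eq_one_right h.symm)
      refine Tendsto.mul_const _ ?_
      refine (Complex.continuous_ofReal.tendsto _).comp ?_
      refine (Real.continuousAt_log hy).tendsto.comp ?_
      refine tendsto_nhdsWithin_of_tendsto_nhds ?_
      have : Continuous fun s : ℝ => ‖1 - s * u * circleMap 0 1 θ‖ := by fun_prop
      simpa using this.tendsto 1
  have hlim2 := hlim.const_smul ((2 * Real.pi)⁻¹ : ℝ)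
  have hlim3 : Tendsto (fun s : ℝ => -((s : ℂ) * u) ^ m / (2 * m)) (𝓝[<] 1)
      (𝓝 (-u ^ m / (2 * m))) := by
    refine tendsto_nhdsWithin_of_tendsto_nhds ?_
    have : Continuous fun s : ℝ => -((s : ℂ) * u) ^ m / (2 * m) := by fun_prop
    simpa using this.tendsto 1
  refine tendsto_nhds_unique hlim2 (hlim3.congr' ?_)
  filter_upwards [hs] with s hs
  have : ‖(s : ℂ) * u‖ < 1 := by
    rw [norm_mul, hu1, Complex.norm_real, Real.norm_of_nonneg hs.1.le]
    linarith [hs.2]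
  rw [← circleAverage_log_norm_one_sub_mul_of_lt this hm, Real.circleAverage_def]

end LogFourier

/-! ### Folding the plane onto the unit disk -/

section ConjFold

open ComplexConjugate

/-- The map `z ↦ conj z` on the closed unit disk and `z ↦ z⁻¹` outside of it. It folds the plane
onto the closed unit disk and agrees with complex conjugation on the unit circle. -/
noncomputable def conjFold (z : ℂ) : ℂ :=
  conj z / ((max 1 ‖z‖ ^ 2 : ℝ) : ℂ)

theorem conjFold_of_norm_le_one {z : ℂ} (hz : ‖z‖ ≤ 1) : conjFold z = conj z := by
  simp [conjFold, max_eq_left hz]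

theorem conjFold_of_one_le_norm {z : ℂ} (hz : 1 ≤ ‖z‖) : conjFold z = z⁻¹ := by
  rw [conjFold, max_eq_right hz, Complex.inv_def, Complex.normSq_eq_norm_sq, div_eq_mul_inv]
  push_cast
  rfl

theorem norm_conjFold_le_one (z : ℂ) : ‖conjFold z‖ ≤ 1 := by
  rcases le_total ‖z‖ 1 with h | h
  · rwa [conjFold_of_norm_le_one h, RCLike.norm_conj]
  · rw [conjFold_of_one_le_norm h, norm_inv]
    exact inv_le_one_of_one_le₀ h

@[fun_prop]
theorem continuous_conjFold : Continuous conjFold := by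
  unfold conjFold
  refine Continuous.div (by fun_prop) (by fun_prop) fun z => ?_
  have : (0 : ℝ) < max 1 ‖z‖ := lt_max_of_lt_left one_pos
  exact_mod_cast (pow_pos this 2).ne'

theorem norm_sub_eq_max_mul_norm_one_sub_conjFold {w : ℂ} (hw : ‖w‖ = 1) (z : ℂ) :
    ‖w - z‖ = max 1 ‖z‖ * ‖1 - conjFold z * w‖ := by
  have hw0 : w ≠ 0 := by rintro rfl; simp at hw
  rcases le_total ‖z‖ 1 with h | h
  · have hcw : conj w = w⁻¹ := by rw [Complex.inv_def, Complex.normSq_eq_norm_sq, hw]; simp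
    rw [conjFold_of_norm_le_one h, max_eq_left h, one_mul, ← RCLike.norm_conj (1 - conj z * w)]
    simp only [map_sub, map_one, map_mul, Complex.conj_conj, hcw]
    rw [← one_mul ‖1 - z * w⁻¹‖, ← hw, ← norm_mul]
    congr 1
    field_simp
  · have hz0 : z ≠ 0 := by rintro rfl; norm_num at h
    rw [conjFold_of_one_le_norm h, max_eq_right h, ← norm_mul, ← norm_sub_rev]
    congr 1
    field_simp

end ConjFold

/-! ### Power sums of folded roots -/

section PolynomialFourier

open Polynomial

theorem ae_eval_circleMap_ne_zero {p : ℂ[X]} (hp : p ≠ 0) :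
    ∀ᵐ θ : ℝ, p.eval (circleMap 0 1 θ) ≠ 0 := by
  have hc : (p.roots.toFinset : Set ℂ).Countable := p.roots.toFinset.countable_toSet
  filter_upwards [(hc.preimage_circleMap 0 one_ne_zero).ae_notMem volume] with θ hθ h
  exact hθ (by simp [hp, h])

theorem circleIntegrable_log_norm_eval_mul (p : ℂ[X]) (m : ℕ) :
    CircleIntegrable (fun w : ℂ => (Real.log ‖p.eval w‖ : ℂ) * w⁻¹ ^ m) 0 1 := by
  have h : IntervalIntegrable (fun θ => ((Real.log ‖p.eval (circleMap 0 1 θ)‖ : ℝ) : ℂ)) volume 0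
      (2 * Real.pi) := by
    have := p.intervalIntegrable_mahlerMeasure
    exact ⟨this.1.ofReal, this.2.ofReal⟩
  refine h.mul_continuousOn (Continuous.continuousOn ?_)
  exact ((continuous_circleMap 0 1).inv₀ fun θ => circleMap_ne_center one_ne_zero).pow m

theorem circleAverage_log_norm_eval_mul_mul {p q : ℂ[X]} (hp : p ≠ 0) (hq : q ≠ 0) (m : ℕ) :
    Real.circleAverage (fun w : ℂ => (Real.log ‖(p * q).eval w‖ : ℂ) * w⁻¹ ^ m) 0 1 =
      Real.circleAverage (fun w : ℂ => (Real.log ‖p.eval w‖ : ℂ) * w⁻¹ ^ m) 0 1 +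
      Real.circleAverage (fun w : ℂ => (Real.log ‖q.eval w‖ : ℂ) * w⁻¹ ^ m) 0 1 := by
  rw [← Real.circleAverage_fun_add (circleIntegrable_log_norm_eval_mul p m)
    (circleIntegrable_log_norm_eval_mul q m), Real.circleAverage_def, Real.circleAverage_def]
  congr 1
  -- the integrands differ only at roots on the circle, where `Real.log 0 = 0` breaks additivity
  refine intervalIntegral.integral_congr_ae ?_
  filter_upwards [ae_eval_circleMap_ne_zero hp, ae_eval_circleMap_ne_zero hq] with θ h1 h2 _
  rw [eval_mul, norm_mul, Real.log_mul (norm_ne_zero_iff.2 h1) (norm_ne_zero_iff.2 h2)]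
  push_cast
  ring

theorem circleAverage_const_mul_inv_pow (c : ℂ) {m : ℕ} (hm : m ≠ 0) :
    Real.circleAverage (fun w : ℂ => c * w⁻¹ ^ m) 0 1 = 0 := by
  have h := circleAverage_zpow (-(m : ℤ))
  rw [if_neg (by omega)] at h
  have := Real.circleAverage_fun_smul (f := fun w : ℂ => w ^ (-(m : ℤ))) (c := 0) (R := 1) (a := c)
  rw [h] at this
  simpa using this

theorem circleAverage_log_norm_eval_X_sub_C_mul (z : ℂ) {m : ℕ} (hm : m ≠ 0) :
    Real.circleAverage (fun w : ℂ => (Real.log ‖(X - C z).eval w‖ : ℂ) * w⁻¹ ^ m) 0 1 =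
      -conjFold z ^ m / (2 * m) := by
  have h1 : CircleIntegrable (fun w : ℂ => (Real.log (max 1 ‖z‖) : ℂ) * w⁻¹ ^ m) 0 1 := by
    refine Continuous.intervalIntegrable ?_ _ _
    exact continuous_const.mul
      (((continuous_circleMap 0 1).inv₀ fun θ => circleMap_ne_center one_ne_zero).pow m)
  have h2 : CircleIntegrable (fun w : ℂ => (Real.log ‖1 - conjFold z * w‖ : ℂ) * w⁻¹ ^ m) 0 1 := by
    have := circleIntegrable_log_norm_eval_mul (1 - C (conjFold z) * X) m
    simpa using this
  have hadd := Real.circleAverage_fun_add h1 h2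
  rw [circleAverage_const_mul_inv_pow _ hm, zero_add,
    circleAverage_log_norm_one_sub_mul (norm_conjFold_le_one z) hm] at hadd
  rw [← hadd, Real.circleAverage_def, Real.circleAverage_def]
  congr 1
  refine intervalIntegral.integral_congr_ae ?_
  filter_upwards [ae_eval_circleMap_ne_zero (X_sub_C_ne_zero z)] with θ hθ _
  have h3 := norm_sub_eq_max_mul_norm_one_sub_conjFold (w := circleMap 0 1 θ) (by simp) z
  have h4 : ‖1 - conjFold z * circleMap 0 1 θ‖ ≠ 0 := by
    intro h
    rw [h, mul_zero, norm_eq_zero] at h3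
    simp [h3] at hθ
  have h5 : max 1 ‖z‖ ≠ 0 := (lt_max_of_lt_left one_pos).ne'
  rw [eval_sub, eval_X, eval_C, h3, Real.log_mul h5 h4]
  push_cast
  ring

theorem circleAverage_log_norm_eval_multiset_prod_mul (s : Multiset ℂ) {m : ℕ} (hm : m ≠ 0) :
    Real.circleAverage (fun w : ℂ =>
      (Real.log ‖(s.map fun z => X - C z).prod.eval w‖ : ℂ) * w⁻¹ ^ m) 0 1 =
      -(s.map fun z => conjFold z ^ m).sum / (2 * m) := by
  induction s using Multiset.induction_on with
  | empty => simp [Real.circleAverage_def]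
  | cons z s ih =>
    have : (s.map fun z => X - C z).prod ≠ 0 := Multiset.prod_ne_zero (by simp [X_sub_C_ne_zero])
    rw [Multiset.map_cons, Multiset.prod_cons, Multiset.map_cons, Multiset.sum_cons,
      circleAverage_log_norm_eval_mul_mul (X_sub_C_ne_zero z) this, ih,
      circleAverage_log_norm_eval_X_sub_C_mul z hm]
    ring

/-- The power sums of the folded roots are Fourier coefficients of `log ‖p‖` on the unit circle:
a version of Jensen's formula for nonzero frequencies. -/
theorem circleAverage_log_norm_eval_mul {p : ℂ[X]} (hp : p ≠ 0) {m : ℕ} (hm : m ≠ 0) :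
    Real.circleAverage (fun w : ℂ => (Real.log ‖p.eval w‖ : ℂ) * w⁻¹ ^ m) 0 1 =
      -(p.roots.map fun z => conjFold z ^ m).sum / (2 * m) := by
  have h : (p.roots.map fun z => X - C z).prod ≠ 0 :=
    Multiset.prod_ne_zero (by simp [X_sub_C_ne_zero])
  have hl : (C p.leadingCoeff : ℂ[X]) ≠ 0 := by simpa using hp
  conv_lhs => rw [(IsAlgClosed.splits p).eq_prod_roots]
  rw [circleAverage_log_norm_eval_mul_mul hl h,
    circleAverage_log_norm_eval_multiset_prod_mul _ hm]
  simp only [eval_C]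
  rw [circleAverage_const_mul_inv_pow _ hm, zero_add]

theorem norm_sum_conjFold_pow_le {p : ℂ[X]} (hp : p ≠ 0) {L : ℝ} (hL : 0 ≤ L)
    (hpL : ∀ w : ℂ, ‖w‖ = 1 → ‖p.eval w‖ ≤ Real.exp L) {m : ℕ} (hm : m ≠ 0) :
    ‖(p.roots.map fun z => conjFold z ^ m).sum‖ ≤ 2 * m * (2 * L - p.logMahlerMeasure) := by
  have hm0 : (0 : ℝ) < m := by exact_mod_cast Nat.pos_of_ne_zero hm
  have h1 : (p.roots.map fun z => conjFold z ^ m).sum = -(2 * m) *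
      Real.circleAverage (fun w : ℂ => (Real.log ‖p.eval w‖ : ℂ) * w⁻¹ ^ m) 0 1 := by
    rw [circleAverage_log_norm_eval_mul hp hm]
    have : (m : ℂ) ≠ 0 := by exact_mod_cast hm
    field_simp
  have hlog : CircleIntegrable (fun w : ℂ => Real.log ‖p.eval w‖) 0 1 :=
    p.intervalIntegrable_mahlerMeasure
  have h2 : ‖Real.circleAverage (fun w : ℂ => (Real.log ‖p.eval w‖ : ℂ) * w⁻¹ ^ m) 0 1‖ ≤
      Real.circleAverage (fun w : ℂ => |Real.log ‖p.eval w‖|) 0 1 := by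
    rw [Real.circleAverage_def, Real.circleAverage_def, norm_smul, smul_eq_mul,
      Real.norm_of_nonneg (by positivity)]
    gcongr
    refine (intervalIntegral.norm_integral_le_integral_norm (by positivity)).trans_eq ?_
    congr 1
    ext θ
    simp
  have h3 : Real.circleAverage (fun w : ℂ => |Real.log ‖p.eval w‖|) 0 1 ≤
      Real.circleAverage (fun w : ℂ => 2 * L - Real.log ‖p.eval w‖) 0 1 := by
    refine Real.circleAverage_mono hlog.abs
      ((circleIntegrable_const (2 * L) 0 1).sub hlog) fun w hw => ?_
    have hw1 : ‖w‖ = 1 := by simpa using hw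
    have h4 : Real.log ‖p.eval w‖ ≤ L := by
      rcases (norm_nonneg (p.eval w)).eq_or_lt with h | h
      · rwa [← h, Real.log_zero]
      · exact (Real.log_le_iff_le_exp h).2 (hpL w hw1)
    exact abs_le.2 ⟨by linarith, by linarith⟩
  have h4 : Real.circleAverage (fun w : ℂ => 2 * L - Real.log ‖p.eval w‖) 0 1 =
      2 * L - p.logMahlerMeasure := by
    rw [Real.circleAverage_fun_sub (circleIntegrable_const (2 * L) 0 1) hlog,
      Real.circleAverage_const, logMahlerMeasure_def]
  rw [h1, norm_mul, norm_neg, norm_mul, RCLike.norm_ofNat, Complex.norm_natCast]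
  gcongr
  linarith

end PolynomialFourier

/-! ### Roots away from the unit circle -/

section RootCounting

open Polynomial

/-- The number of entries `z` of `s` with `R ≤ ‖z‖`. -/
noncomputable def countOutside (R : ℝ) (s : Multiset ℂ) : ℝ :=
  (s.map fun z => if R ≤ ‖z‖ then (1 : ℝ) else 0).sum

/-- The number of entries `z` of `s` with `‖z‖ ≤ R⁻¹`. -/
noncomputable def countInside (R : ℝ) (s : Multiset ℂ) : ℝ :=
  (s.map fun z => if ‖z‖ ≤ R⁻¹ then (1 : ℝ) else 0).sum

theorem countOutside_nonneg (R : ℝ) (s : Multiset ℂ) : 0 ≤ countOutside R s := by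
  refine Multiset.sum_nonneg fun x hx => ?_
  obtain ⟨z, -, rfl⟩ := Multiset.mem_map.1 hx
  split_ifs <;> norm_num

theorem countInside_nonneg (R : ℝ) (s : Multiset ℂ) : 0 ≤ countInside R s := by
  refine Multiset.sum_nonneg fun x hx => ?_
  obtain ⟨z, -, rfl⟩ := Multiset.mem_map.1 hx
  split_ifs <;> norm_num

theorem logMahlerMeasure_le {p : ℂ[X]} {L : ℝ} (hL : 0 ≤ L)
    (hpL : ∀ w : ℂ, ‖w‖ = 1 → ‖p.eval w‖ ≤ Real.exp L) : p.logMahlerMeasure ≤ L := by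
  refine Real.circleAverage_mono_on_of_le_circle p.intervalIntegrable_mahlerMeasure fun w hw => ?_
  rcases (norm_nonneg (p.eval w)).eq_or_lt with h | h
  · rwa [← h, Real.log_zero]
  · exact (Real.log_le_iff_le_exp h).2 (hpL w (by simpa using hw))

/-- Mahler's coefficient bound applied to the polynomial whose roots are those of `p` scaled
by `r`. -/
theorem log_norm_coeff_add_le (p : ℂ[X]) {r : ℝ} (hr : 0 < r) {k : ℕ} (hk : p.coeff k ≠ 0) :
    Real.log ‖p.coeff k‖ + (p.natDegree - k : ℝ) * Real.log r ≤
      Real.log (p.natDegree.choose k) + Real.log ‖p.leadingCoeff‖ +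
        (p.roots.map fun z => Real.posLog (r * ‖z‖)).sum := by
  have hkd : k ≤ p.natDegree := le_natDegree_of_ne_zero hk
  have hr0 : (r : ℂ) ≠ 0 := by exact_mod_cast hr.ne'
  have h0 : (p.scaleRoots (r : ℂ)) ≠ 0 := by
    intro h
    have := coeff_scaleRoots p (r : ℂ) k
    rw [h, coeff_zero] at this
    exact mul_ne_zero hk (pow_ne_zero _ hr0) this.symm
  have h := norm_coeff_le_choose_mul_mahlerMeasure k (p.scaleRoots (r : ℂ))
  rw [coeff_scaleRoots, natDegree_scaleRoots, norm_mul, norm_pow, Complex.norm_real,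
    Real.norm_of_nonneg hr.le] at h
  have hch : (0 : ℝ) < p.natDegree.choose k := by exact_mod_cast Nat.choose_pos hkd
  have h1 := Real.log_le_log (by positivity) h
  rw [Real.log_mul (norm_ne_zero_iff.2 hk) (by positivity), Real.log_pow, Nat.cast_sub hkd,
    Real.log_mul hch.ne' (mahlerMeasure_pos_of_ne_zero h0).ne',
    ← logMahlerMeasure_eq_log_MahlerMeasure,
    logMahlerMeasure_eq_log_leadingCoeff_add_sum_log_roots, leadingCoeff_scaleRoots,
    roots_scaleRoots p (IsUnit.mk0 _ hr0), Multiset.map_map] at h1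
  simpa [add_assoc, abs_of_pos hr] using h1

theorem log_norm_coeff_le_log_choose_add (p : ℂ[X]) {k : ℕ} (hk : p.coeff k ≠ 0) :
    Real.log ‖p.coeff k‖ ≤ Real.log (p.natDegree.choose k) + p.logMahlerMeasure := by
  have := log_norm_coeff_add_le p one_pos hk
  rw [logMahlerMeasure_eq_log_leadingCoeff_add_sum_log_roots]
  simpa [add_assoc] using this

/-- A coefficient which is not too small and whose index is close to the degree forces most roots
to lie in `‖z‖ < R`. -/
theorem countOutside_mul_log_le (p : ℂ[X]) {R : ℝ} (hR : 1 < R) {k : ℕ} (hk : p.coeff k ≠ 0) :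
    countOutside R p.roots * Real.log R ≤ Real.log (p.natDegree.choose k) + p.logMahlerMeasure -
      Real.log ‖p.coeff k‖ + (p.natDegree - k : ℝ) * Real.log R := by
  have hR0 : 0 < R := by linarith
  have h := log_norm_coeff_add_le p (inv_pos.2 hR0) hk
  have hs : (p.roots.map fun z => Real.posLog (R⁻¹ * ‖z‖)).sum ≤
      (p.roots.map fun z => Real.posLog ‖z‖ -
        (if R ≤ ‖z‖ then (1 : ℝ) else 0) * Real.log R).sum := by
    refine Multiset.sum_map_le_sum_map _ _ fun z _ => ?_
    split_ifs with hz
    · have hz0 : 0 < ‖z‖ := hR0.trans_le hz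
      have h1 : 1 ≤ |R⁻¹ * ‖z‖| := by
        rwa [abs_of_nonneg (by positivity), inv_mul_eq_div, one_le_div hR0]
      rw [Real.posLog_eq_log h1,
        Real.posLog_eq_log (by rw [abs_of_pos hz0]; linarith),
        Real.log_mul (inv_ne_zero hR0.ne') hz0.ne', Real.log_inv]
      linarith
    · rw [zero_mul, sub_zero]
      exact Real.posLog_le_posLog (by positivity)
        (mul_le_of_le_one_left (norm_nonneg z) (inv_le_one_of_one_le₀ hR.le))
  rw [Multiset.sum_map_sub, Multiset.sum_map_mul_right] at hs
  rw [Real.log_inv] at h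
  rw [logMahlerMeasure_eq_log_leadingCoeff_add_sum_log_roots, countOutside]
  linarith

/-- A coefficient which is not too small and whose index is small forces most roots to lie
in `R⁻¹ < ‖z‖`. -/
theorem countInside_mul_log_le (p : ℂ[X]) {R : ℝ} (hR : 1 < R) {k : ℕ} (hk : p.coeff k ≠ 0) :
    countInside R p.roots * Real.log R ≤ Real.log (p.natDegree.choose k) + p.logMahlerMeasure -
      Real.log ‖p.coeff k‖ + k * Real.log R := by
  have hR0 : 0 < R := by linarith
  have hlR : 0 < Real.log R := Real.log_pos hR
  have h := log_norm_coeff_add_le p hR0 hk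
  have hs : (p.roots.map fun z => Real.posLog (R * ‖z‖)).sum ≤
      (p.roots.map fun z => Real.posLog ‖z‖ + Real.log R -
        (if ‖z‖ ≤ R⁻¹ then (1 : ℝ) else 0) * Real.log R).sum := by
    refine Multiset.sum_map_le_sum_map _ _ fun z _ => ?_
    split_ifs with hz
    · have : R * ‖z‖ ≤ 1 := by
        calc R * ‖z‖ ≤ R * R⁻¹ := by gcongr
          _ = 1 := mul_inv_cancel₀ hR0.ne'
      rw [(Real.posLog_eq_zero_iff _).2 (by rwa [abs_of_nonneg (by positivity)])]
      linarith [Real.posLog_nonneg (x := ‖z‖)]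
    · have := Real.posLog_mul (x := R) (y := ‖z‖)
      rw [Real.posLog_eq_log (x := R) (by rw [abs_of_pos hR0]; exact hR.le)] at this
      linarith
  rw [Multiset.sum_map_sub, Multiset.sum_map_mul_right, Multiset.sum_map_add,
    Multiset.map_const', Multiset.sum_replicate, nsmul_eq_mul,
    IsAlgClosed.card_roots_eq_natDegree] at hs
  rw [logMahlerMeasure_eq_log_leadingCoeff_add_sum_log_roots, countInside]
  linarith

end RootCounting

/-! ### Growth of binomial coefficients -/

section Choose

theorem log_choose_le {n k : ℕ} (hk : k ≤ n) {x : ℝ} (hx : 0 < x) :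
    Real.log (n.choose k) ≤ n * x - k * Real.log x := by
  have hch : (0 : ℝ) < n.choose k := by exact_mod_cast Nat.choose_pos hk
  have h1 : (n.choose k : ℝ) * x ^ k ≤ (x + 1) ^ n := by
    rw [add_pow]
    refine le_trans (le_of_eq ?_) (Finset.single_le_sum
      (f := fun m => x ^ m * 1 ^ (n - m) * (n.choose m : ℝ)) (fun i _ => by positivity)
      (Finset.mem_range_succ_iff.2 hk))
    simp [mul_comm]
  have h2 := Real.log_le_log (by positivity) h1
  rw [Real.log_mul hch.ne' (by positivity), Real.log_pow, Real.log_pow] at h2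
  have h3 := Real.log_le_sub_one_of_pos (x := x + 1) (by positivity)
  have h4 : (n : ℝ) * Real.log (x + 1) ≤ n * x := by
    gcongr
    linarith
  linarith

/-- Binomial coefficients `d.choose j` with `d ≤ n` and `j = o(n)` grow subexponentially. -/
theorem tendsto_log_choose_div {d j : ℕ → ℕ} (hjd : ∀ᶠ n in atTop, j n ≤ d n)
    (hdn : ∀ n, d n ≤ n) (hj : Tendsto (fun n : ℕ => (j n : ℝ) / n) atTop (𝓝 0)) :
    Tendsto (fun n : ℕ => Real.log ((d n).choose (j n)) / n) atTop (𝓝 0) := by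
  rw [tendsto_order]
  refine ⟨fun ε hε => Eventually.of_forall fun n => hε.trans_le ?_, fun ε hε => ?_⟩
  · exact div_nonneg (Real.log_natCast_nonneg _) (Nat.cast_nonneg _)
  · -- the bound `log_choose_le` at `x = ε / 2`, divided by `n`
    have h1 : Tendsto (fun n : ℕ => ε / 2 - (j n : ℝ) / n * Real.log (ε / 2)) atTop (𝓝 (ε / 2)) := by
      simpa using (hj.mul_const (Real.log (ε / 2))).const_sub (ε / 2)
    filter_upwards [h1.eventually_lt_const (half_lt_self hε), hjd, eventually_gt_atTop 0]
      with n hn hjn hn0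
    have hn0' : (0 : ℝ) < n := by exact_mod_cast hn0
    refine lt_of_le_of_lt ?_ hn
    rw [div_le_iff₀ hn0']
    have h2 := log_choose_le hjn (half_pos hε)
    have h3 : (d n : ℝ) * (ε / 2) ≤ n * (ε / 2) := by
      gcongr
      exact_mod_cast hdn n
    have h4 : (ε / 2 - (j n : ℝ) / n * Real.log (ε / 2)) * n =
        n * (ε / 2) - j n * Real.log (ε / 2) := by
      field_simp
    linarith

end Choose

/-! ### A Weyl criterion on the unit circle -/

section Equidistribution

open ComplexConjugate

/-- The normalized sum `n⁻¹ ∑ f z` over the entries `z` of `s`. The normalization `n` need not be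
the cardinality of `s`. -/
noncomputable def multisetAverage (s : Multiset ℂ) (n : ℕ) (f : ℂ → ℂ) : ℂ :=
  (n : ℂ)⁻¹ * (s.map f).sum

theorem multisetAverage_add (s : Multiset ℂ) (n : ℕ) (f g : ℂ → ℂ) :
    multisetAverage s n (f + g) = multisetAverage s n f + multisetAverage s n g := by
  simp [multisetAverage, Multiset.sum_map_add, mul_add]

theorem multisetAverage_sub (s : Multiset ℂ) (n : ℕ) (f g : ℂ → ℂ) :
    multisetAverage s n (f - g) = multisetAverage s n f - multisetAverage s n g := by
  simp [multisetAverage, Multiset.sum_map_sub, mul_sub]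

theorem multisetAverage_smul (s : Multiset ℂ) (n : ℕ) (c : ℂ) (f : ℂ → ℂ) :
    multisetAverage s n (c • f) = c * multisetAverage s n f := by
  simp only [multisetAverage, Pi.smul_apply, smul_eq_mul, Multiset.sum_map_mul_left]
  ring

theorem multisetAverage_conj (s : Multiset ℂ) (n : ℕ) (f : ℂ → ℂ) :
    multisetAverage s n (fun z => conj (f z)) = conj (multisetAverage s n f) := by
  have : (s.map fun z => conj (f z)).sum = conj (s.map f).sum := by
    rw [map_multiset_sum, Multiset.map_map]
    rfl
  simp [multisetAverage, this]

/-- A continuous function bounded by `ε` on the unit circle is bounded by `2 * ε` on an annulus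
around it. -/
theorem exists_annulus_norm_le {f : ℂ → ℂ} (hf : Continuous f) {ε : ℝ} (hε : 0 < ε)
    (h : ∀ w : ℂ, ‖w‖ = 1 → ‖f w‖ ≤ ε) :
    ∃ R : ℝ, 1 < R ∧ ∀ z : ℂ, R⁻¹ < ‖z‖ → ‖z‖ < R → ‖f z‖ ≤ 2 * ε := by
  have hopen : IsOpen {z : ℂ | ‖f z‖ < 2 * ε} := isOpen_lt (by fun_prop) continuous_const
  obtain ⟨δ, hδ, hsub⟩ := (isCompact_sphere (0 : ℂ) 1).exists_thickening_subset_open hopen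
    (fun w hw => by
      have := h w (by simpa using hw)
      simp only [Set.mem_ofPred_eq]
      linarith)
  refine ⟨1 + δ, by linarith, fun z h1 h2 => (hsub ?_).le⟩
  have hz : 0 < ‖z‖ := lt_trans (by positivity) h1
  have hz0 : (‖z‖ : ℂ) ≠ 0 := by exact_mod_cast hz.ne'
  refine Metric.mem_thickening_iff.2 ⟨z / ‖z‖, by simp [hz.ne'], ?_⟩
  have e : z - z / ‖z‖ = (z / ‖z‖) * ((‖z‖ - 1 : ℝ) : ℂ) := by
    push_cast
    field_simp
  rw [dist_eq_norm, e, norm_mul, norm_div, Complex.norm_real, Complex.norm_real, norm_norm,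
    div_self hz.ne', one_mul, Real.norm_eq_abs, abs_lt]
  have h3 : 1 - δ < (1 + δ)⁻¹ := by
    rw [← one_div, lt_div_iff₀ (by linarith)]
    nlinarith
  constructor <;> linarith

theorem norm_sum_le_of_annulus {f : ℂ → ℂ} {C ε R : ℝ} (hC : ∀ z, ‖f z‖ ≤ C) (hε : 0 ≤ ε)
    (h : ∀ z : ℂ, R⁻¹ < ‖z‖ → ‖z‖ < R → ‖f z‖ ≤ ε) (s : Multiset ℂ) :
    ‖(s.map f).sum‖ ≤ ε * Multiset.card s + C * (countInside R s + countOutside R s) := by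
  have hC0 : 0 ≤ C := (norm_nonneg _).trans (hC 0)
  have h1 : ‖(s.map f).sum‖ ≤ (s.map fun z => ‖f z‖).sum := by
    have := norm_multiset_sum_le (s.map f)
    rwa [Multiset.map_map] at this
  refine h1.trans ?_
  have h2 : (s.map fun z => ‖f z‖).sum ≤ (s.map fun z => ε +
      C * ((if ‖z‖ ≤ R⁻¹ then (1 : ℝ) else 0) + (if R ≤ ‖z‖ then (1 : ℝ) else 0))).sum := by
    refine Multiset.sum_map_le_sum_map _ _ fun z _ => ?_
    have := hC z
    split_ifs with h3 h4 h4
    · linarith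
    · linarith
    · linarith
    · have := h z (not_le.1 h3) (not_le.1 h4)
      linarith
  refine h2.trans_eq ?_
  rw [Multiset.sum_map_add, Multiset.sum_map_mul_left, Multiset.sum_map_add, Multiset.map_const',
    Multiset.sum_replicate, nsmul_eq_mul, countInside, countOutside, mul_comm ε]

theorem norm_circleAverage_le {f : ℂ → ℂ} {ε : ℝ} (h : ∀ w : ℂ, ‖w‖ = 1 → ‖f w‖ ≤ ε) :
    ‖Real.circleAverage f 0 1‖ ≤ ε := by
  rw [Real.circleAverage_def, norm_smul, Real.norm_of_nonneg (by positivity)]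
  have := intervalIntegral.norm_integral_le_of_norm_le_const (a := 0) (b := 2 * Real.pi)
    (f := fun θ => f (circleMap 0 1 θ)) (C := ε) fun θ _ => h _ (by simp)
  rw [sub_zero, abs_of_pos Real.two_pi_pos] at this
  calc (2 * Real.pi)⁻¹ * ‖∫ θ in (0 : ℝ)..2 * Real.pi, f (circleMap 0 1 θ)‖
      ≤ (2 * Real.pi)⁻¹ * (ε * (2 * Real.pi)) := by gcongr
    _ = ε := by field_simp

theorem _root_.Continuous.circleIntegrable_zero_one {f : ℂ → ℂ} (hf : Continuous f) :
    CircleIntegrable f 0 1 :=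
  hf.continuousOn.circleIntegrable zero_le_one

variable {s : ℕ → Multiset ℂ}

/-- If the folded power sums are negligible then every trigonometric polynomial on the unit circle
extends to a bounded continuous function whose averages over `s n` converge to its mean. -/
theorem exists_extension_of_mem_span_fourier
    (hcard : Tendsto (fun n : ℕ => (Multiset.card (s n) : ℝ) / n) atTop (𝓝 1))
    (hpow : ∀ m : ℕ, m ≠ 0 →
      Tendsto (fun n => multisetAverage (s n) n fun z => conjFold z ^ m) atTop (𝓝 0))
    {t : C(UnitAddCircle, ℂ)} (ht : t ∈ Submodule.span ℂ (Set.range (fourier (T := 1)))) :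
    ∃ h : ℂ → ℂ, Continuous h ∧ (∃ C, ∀ z, ‖h z‖ ≤ C) ∧
      (∀ x : UnitAddCircle, h (AddCircle.toCircle x : Circle) = t x) ∧
      Tendsto (fun n => multisetAverage (s n) n h) atTop (𝓝 (Real.circleAverage h 0 1)) := by
  have havg : ∀ (h : ℂ → ℂ) (j : ℤ), (∀ w : ℂ, ‖w‖ = 1 → h w = w ^ j) →
      Real.circleAverage h 0 1 = if j = 0 then 1 else 0 := by
    intro h j hj
    rw [← circleAverage_zpow j]
    refine Real.circleAverage_congr_sphere fun w hw => hj w ?_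
    simpa using hw
  have hconj : ∀ w : ℂ, ‖w‖ = 1 → conjFold w = w⁻¹ := fun w hw =>
    conjFold_of_one_le_norm hw.ge
  have hconj' : ∀ w : ℂ, ‖w‖ = 1 → conj (conjFold w) = w := fun w hw => by
    rw [conjFold_of_norm_le_one hw.le, Complex.conj_conj]
  have hbd : ∀ (m : ℕ) (z : ℂ), ‖conjFold z ^ m‖ ≤ 1 := fun m z => by
    rw [norm_pow]
    exact pow_le_one₀ (norm_nonneg _) (norm_conjFold_le_one z)
  induction ht using Submodule.span_induction with
  | mem t ht =>
    obtain ⟨j, rfl⟩ := ht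
    have hx : ∀ x : UnitAddCircle, fourier j x = (AddCircle.toCircle x : ℂ) ^ j := by
      intro x
      rw [fourier_apply, AddCircle.toCircle_zsmul, Circle.coe_zpow]
    obtain ⟨m, rfl | rfl⟩ := j.eq_nat_or_neg
    · have hw : ∀ w : ℂ, ‖w‖ = 1 → conj (conjFold w ^ m) = w ^ (m : ℤ) := fun w hw => by
        rw [map_pow, hconj' w hw, zpow_natCast]
      refine ⟨fun z => conj (conjFold z ^ m), by fun_prop, ⟨1, fun z => ?_⟩, fun x => ?_, ?_⟩
      · rw [RCLike.norm_conj]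
        exact hbd m z
      · exact (hw _ (Circle.norm_coe _)).trans (hx x).symm
      · rw [havg _ _ hw]
        split_ifs with h0
        · obtain rfl : m = 0 := by exact_mod_cast h0
          have := (Complex.continuous_ofReal.tendsto 1).comp hcard
          refine (this.congr fun n => ?_)
          simp [multisetAverage, div_eq_inv_mul]
        · have := (Complex.continuous_conj.tendsto 0).comp (hpow m (by exact_mod_cast h0))
          simp only [map_zero] at this
          exact this.congr fun n => (multisetAverage_conj _ _ _).symm
    · have hw : ∀ w : ℂ, ‖w‖ = 1 → conjFold w ^ m = w ^ (-(m : ℤ)) := fun w hw => by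
        rw [hconj w hw, zpow_neg, zpow_natCast, inv_pow]
      refine ⟨fun z => conjFold z ^ m, by fun_prop, ⟨1, hbd m⟩, fun x => ?_, ?_⟩
      · exact (hw _ (Circle.norm_coe _)).trans (hx x).symm
      · rw [havg _ _ hw]
        split_ifs with h0
        · obtain rfl : m = 0 := by omega
          have := (Complex.continuous_ofReal.tendsto 1).comp hcard
          refine (this.congr fun n => ?_)
          simp [multisetAverage, div_eq_inv_mul]
        · exact hpow m (by omega)
  | zero =>
    refine ⟨0, continuous_const, ⟨0, by simp⟩, by simp, ?_⟩
    have : Real.circleAverage (0 : ℂ → ℂ) 0 1 = 0 := by simp [Real.circleAverage_def]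
    rw [this]
    simp [multisetAverage]
  | add t₁ t₂ _ _ ih₁ ih₂ =>
    obtain ⟨h₁, c₁, ⟨C₁, b₁⟩, e₁, l₁⟩ := ih₁
    obtain ⟨h₂, c₂, ⟨C₂, b₂⟩, e₂, l₂⟩ := ih₂
    refine ⟨h₁ + h₂, c₁.add c₂, ⟨C₁ + C₂, fun z => (norm_add_le _ _).trans
      (add_le_add (b₁ z) (b₂ z))⟩, fun x => by simp [e₁, e₂], ?_⟩
    rw [Real.circleAverage_add c₁.circleIntegrable_zero_one c₂.circleIntegrable_zero_one]
    simpa only [multisetAverage_add] using l₁.add l₂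
  | smul c t _ ih =>
    obtain ⟨h, c₁, ⟨C, b⟩, e, l⟩ := ih
    refine ⟨c • h, c₁.const_smul c, ⟨‖c‖ * C, fun z => ?_⟩, fun x => by simp [e], ?_⟩
    · rw [Pi.smul_apply, norm_smul]
      exact mul_le_mul_of_nonneg_left (b z) (norm_nonneg c)
    · rw [Real.circleAverage_smul]
      simpa only [multisetAverage_smul, smul_eq_mul] using l.const_mul c

/-- Weyl-type criterion: the points of `s n` equidistribute on the unit circle if all but `o(n)` of
them lie close to the circle and the folded power sums are `o(n)`. -/
theorem tendsto_multisetAverage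
    (hcard : Tendsto (fun n : ℕ => (Multiset.card (s n) : ℝ) / n) atTop (𝓝 1))
    (hin : ∀ R : ℝ, 1 < R → Tendsto (fun n : ℕ => countInside R (s n) / n) atTop (𝓝 0))
    (hout : ∀ R : ℝ, 1 < R → Tendsto (fun n : ℕ => countOutside R (s n) / n) atTop (𝓝 0))
    (hpow : ∀ m : ℕ, m ≠ 0 →
      Tendsto (fun n => multisetAverage (s n) n fun z => conjFold z ^ m) atTop (𝓝 0))
    {f : ℂ → ℂ} (hf : Continuous f) {C : ℝ} (hC : ∀ z, ‖f z‖ ≤ C) :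
    Tendsto (fun n => multisetAverage (s n) n f) atTop (𝓝 (Real.circleAverage f 0 1)) := by
  rw [Metric.tendsto_atTop']
  suffices H : ∀ ε : ℝ, 0 < ε → ∀ᶠ n in atTop,
      dist (multisetAverage (s n) n f) (Real.circleAverage f 0 1) < 6 * ε by
    intro ε hε
    have := H (ε / 6) (by positivity)
    rw [mul_div_cancel₀ _ (by norm_num : (6 : ℝ) ≠ 0)] at this
    obtain ⟨N, hN⟩ := eventually_atTop.1 this
    exact ⟨N, fun n hn => hN n hn.le⟩
  intro ε hε
  let g : C(UnitAddCircle, ℂ) := ⟨fun x => f (AddCircle.toCircle x),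
    hf.comp (continuous_subtype_val.comp AddCircle.continuous_toCircle)⟩
  have hg : g ∈ (Submodule.span ℂ (Set.range (fourier (T := 1)))).topologicalClosure := by
    rw [span_fourier_closure_eq_top]
    trivial
  obtain ⟨t, ht, hgt⟩ := Metric.mem_closure_iff.1 hg ε hε
  obtain ⟨h, hcont, ⟨D, hD⟩, hx, hlim⟩ := exists_extension_of_mem_span_fourier hcard hpow ht
  have hcirc : ∀ w : ℂ, ‖w‖ = 1 → ‖(f - h) w‖ ≤ ε := by
    intro w hw
    obtain ⟨x, hxw⟩ := (AddCircle.homeomorphCircle (T := 1) one_ne_zero).surjective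
      ⟨w, mem_sphere_zero_iff_norm.2 hw⟩
    rw [AddCircle.homeomorphCircle_apply] at hxw
    have e : ((AddCircle.toCircle x : Circle) : ℂ) = w := by rw [hxw]
    have := (ContinuousMap.dist_apply_le_dist x).trans hgt.le
    rw [← hx, dist_eq_norm] at this
    simpa [g, e] using this
  obtain ⟨R, hR, hann⟩ := exists_annulus_norm_le (hf.sub hcont) hε hcirc
  have hb : ∀ z, ‖(f - h) z‖ ≤ C + D := fun z =>
    (norm_sub_le _ _).trans (add_le_add (hC z) (hD z))
  have hlim2 : Tendsto (fun n : ℕ => 2 * ε * ((Multiset.card (s n) : ℝ) / n) +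
      (C + D) * (countInside R (s n) / n + countOutside R (s n) / n)) atTop (𝓝 (2 * ε)) := by
    simpa using (hcard.const_mul (2 * ε)).add (((hin R hR).add (hout R hR)).const_mul (C + D))
  filter_upwards [hlim2.eventually_lt_const (by linarith : 2 * ε < 3 * ε),
    Metric.tendsto_nhds.1 hlim ε hε] with n h1 h2
  have h3 : ‖multisetAverage (s n) n (f - h)‖ < 3 * ε := by
    refine lt_of_le_of_lt ?_ h1
    rw [multisetAverage, norm_mul, norm_inv, Complex.norm_natCast]
    calc (n : ℝ)⁻¹ * ‖((s n).map (f - h)).sum‖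
        ≤ (n : ℝ)⁻¹ * (2 * ε * Multiset.card (s n) +
          (C + D) * (countInside R (s n) + countOutside R (s n))) := by
          gcongr
          exact norm_sum_le_of_annulus hb (by positivity) hann _
      _ = _ := by ring
  have h4 : ‖Real.circleAverage (f - h) 0 1‖ ≤ ε := norm_circleAverage_le hcirc
  rw [Real.circleAverage_sub hf.circleIntegrable_zero_one hcont.circleIntegrable_zero_one] at h4
  rw [multisetAverage_sub] at h3
  rw [dist_eq_norm] at h2 ⊢
  calc ‖multisetAverage (s n) n f - Real.circleAverage f 0 1‖
      = ‖(multisetAverage (s n) n f - multisetAverage (s n) n h) +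
        (multisetAverage (s n) n h - Real.circleAverage h 0 1) -
        (Real.circleAverage f 0 1 - Real.circleAverage h 0 1)‖ := by congr 1; ring
    _ ≤ ‖multisetAverage (s n) n f - multisetAverage (s n) n h‖ +
        ‖multisetAverage (s n) n h - Real.circleAverage h 0 1‖ +
        ‖Real.circleAverage f 0 1 - Real.circleAverage h 0 1‖ :=
        (norm_sub_le _ _).trans (add_le_add_left (norm_add_le _ _) _)
    _ < 6 * ε := by linarith

end Equidistribution

/-! ### Integrals against the measures -/

section Measures

theorem integral_circleUniform (f : BoundedContinuousFunction ℂ ℂ) :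
    ∫ z, f z ∂(circleUniform.toFiniteMeasure : Measure ℂ) = Real.circleAverage f 0 1 := by
  have hm : Measurable fun θ : ℝ => Complex.exp ((θ : ℂ) * Complex.I) := by fun_prop
  have e : (circleUniform.toFiniteMeasure : Measure ℂ) =
    (ENNReal.ofReal (2 * Real.pi))⁻¹ • circleArcLength := rfl
  rw [e, integral_smul_measure, circleArcLength,
    integral_map hm.aemeasurable f.continuous.aestronglyMeasurable, Real.circleAverage_def,
    intervalIntegral.integral_of_le Real.two_pi_pos.le, ENNReal.toReal_inv,
    ENNReal.toReal_ofReal Real.two_pi_pos.le]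
  simp [circleMap_zero]

theorem integral_zeroCountingMeasure (p : Polynomial ℂ) (f : BoundedContinuousFunction ℂ ℂ) :
    ∫ z, f z ∂(zeroCountingMeasure p : Measure ℂ) = (p.roots.map f).sum := by
  unfold zeroCountingMeasure
  induction p.roots using Multiset.induction_on with
  | empty => simp
  | cons z s ih =>
    rw [Multiset.map_cons, Multiset.sum_cons, Multiset.map_cons, Multiset.sum_cons,
      FiniteMeasure.toMeasure_add, integral_add_measure (f.integrable _) (f.integrable _), ih]
    congr 1
    exact integral_dirac f z

theorem integral_empiricalZeroMeasure (a : ℕ → ℂ) (n : ℕ) (f : BoundedContinuousFunction ℂ ℂ) :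
    ∫ z, f z ∂(empiricalZeroMeasure a n : Measure ℂ) =
      multisetAverage (coeffPoly a n).roots n f := by
  rw [empiricalZeroMeasure, FiniteMeasure.toMeasure_smul, integral_smul_nnreal_measure,
    integral_zeroCountingMeasure, multisetAverage, NNReal.smul_def]
  simp

end Measures

/-! ### Equidistribution for deterministic coefficients -/

section CoeffPoly

theorem coeff_coeffPoly (a : ℕ → ℂ) (n j : ℕ) :
    (coeffPoly a n).coeff j = if j ≤ n then a j else 0 := by
  simp [coeffPoly, Polynomial.finsetSum_coeff, Polynomial.coeff_monomial]

theorem natDegree_coeffPoly_le (a : ℕ → ℂ) (n : ℕ) : (coeffPoly a n).natDegree ≤ n := by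
  rw [Polynomial.natDegree_le_iff_coeff_eq_zero]
  intro j hj
  rw [coeff_coeffPoly, if_neg (by omega)]

theorem norm_eval_coeffPoly_le (a : ℕ → ℂ) (n : ℕ) {w : ℂ} (hw : ‖w‖ = 1) :
    ‖(coeffPoly a n).eval w‖ ≤ ∑ j ∈ Finset.range (n + 1), ‖a j‖ := by
  rw [coeffPoly, Polynomial.eval_finsetSum]
  refine (norm_sum_le _ _).trans (Finset.sum_le_sum fun j _ => ?_)
  simp [hw]

/-- If the coefficients grow subexponentially then so do the sums of their norms. -/
theorem tendsto_log_one_add_sum_div {a : ℕ → ℂ}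
    (ha : Tendsto (fun n : ℕ => Real.log (1 + ‖a n‖) / n) atTop (𝓝 0)) :
    Tendsto (fun n : ℕ => Real.log (1 + ∑ j ∈ Finset.range (n + 1), ‖a j‖) / n) atTop (𝓝 0) := by
  have hX : ∀ j, 0 ≤ Real.log (1 + ‖a j‖) := fun j => Real.log_nonneg (by simp)
  rw [tendsto_order]
  refine ⟨fun ε hε => Eventually.of_forall fun n => hε.trans_le ?_, fun ε hε => ?_⟩
  · refine div_nonneg (Real.log_nonneg ?_) (Nat.cast_nonneg _)
    have : 0 ≤ ∑ j ∈ Finset.range (n + 1), ‖a j‖ := Finset.sum_nonneg fun _ _ => norm_nonneg _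
    linarith
  obtain ⟨K, hK⟩ := eventually_atTop.1
    ((ha.eventually_lt_const (half_pos hε)).and (eventually_gt_atTop 0))
  set C := ∑ j ∈ Finset.range K, Real.log (1 + ‖a j‖) with hC
  have hC0 : 0 ≤ C := Finset.sum_nonneg fun j _ => hX j
  have hle : ∀ n j, j ≤ n → ‖a j‖ ≤ Real.exp (C + ε / 2 * n) := by
    intro n j hj
    have h1 : Real.log (1 + ‖a j‖) ≤ C + ε / 2 * n := by
      have hn : 0 ≤ ε / 2 * n := by positivity
      rcases lt_or_ge j K with h | h
      · have := Finset.single_le_sum (f := fun j => Real.log (1 + ‖a j‖)) (fun j _ => hX j)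
          (Finset.mem_range.2 h)
        linarith
      · obtain ⟨h2, h3⟩ := hK j h
        have h4 : (0 : ℝ) < j := by exact_mod_cast h3
        rw [div_lt_iff₀ h4] at h2
        have h5 : ε / 2 * j ≤ ε / 2 * n := by
          gcongr
        linarith
    rw [Real.log_le_iff_le_exp (by positivity)] at h1
    linarith
  have hsum : ∀ n : ℕ, Real.log (1 + ∑ j ∈ Finset.range (n + 1), ‖a j‖) ≤
      Real.log ((n + 2 : ℕ) : ℝ) + (C + ε / 2 * n) := by
    intro n
    have h1 : ∑ j ∈ Finset.range (n + 1), ‖a j‖ ≤ (n + 1) * Real.exp (C + ε / 2 * n) := by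
      have := Finset.sum_le_card_nsmul (Finset.range (n + 1)) (fun j => ‖a j‖)
        (Real.exp (C + ε / 2 * n)) fun j hj => hle n j (Finset.mem_range_succ_iff.1 hj)
      simpa using this
    have h2 : 1 ≤ Real.exp (C + ε / 2 * n) := Real.one_le_exp (by positivity)
    have h3 : 0 ≤ ∑ j ∈ Finset.range (n + 1), ‖a j‖ := Finset.sum_nonneg fun _ _ => norm_nonneg _
    rw [← Real.log_exp (C + ε / 2 * n), ← Real.log_mul (by positivity) (by positivity)]
    refine Real.log_le_log (by positivity) ?_
    push_cast
    linarith
  have hlog : Tendsto (fun n : ℕ => Real.log ((n + 2 : ℕ) : ℝ) / n) atTop (𝓝 0) := by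
    have h1 : Tendsto (fun x : ℝ => Real.log x / (1 * x + (-2))) atTop (𝓝 0) := by
      simpa using Real.tendsto_pow_log_div_mul_add_atTop 1 (-2) 1 one_ne_zero
    have h2 : Tendsto (fun n : ℕ => ((n + 2 : ℕ) : ℝ)) atTop atTop :=
      tendsto_natCast_atTop_atTop.comp (tendsto_add_atTop_nat 2)
    refine (h1.comp h2).congr fun n => ?_
    simp
  have hfin : Tendsto (fun n : ℕ => Real.log ((n + 2 : ℕ) : ℝ) / n + C / n + ε / 2) atTop
      (𝓝 (ε / 2)) := by
    simpa using (hlog.add (tendsto_const_div_atTop_nhds_zero_nat C)).add_const (ε / 2)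
  filter_upwards [hfin.eventually_lt_const (half_lt_self hε), eventually_gt_atTop 0] with n hn hn0
  have hn0' : (0 : ℝ) < n := by exact_mod_cast hn0
  refine lt_of_le_of_lt ?_ hn
  rw [div_le_iff₀ hn0']
  refine (hsum n).trans_eq ?_
  field_simp
  ring

/-- The zeros of `a₀ + a₁ z + ⋯ + aₙ zⁿ` equidistribute on the unit circle as soon as the
coefficients grow subexponentially and some coefficient of index `k n ∼ n` stays away from zero. -/
theorem tendsto_empiricalZeroMeasure {a : ℕ → ℂ}
    (ha : Tendsto (fun n : ℕ => Real.log (1 + ‖a n‖) / n) atTop (𝓝 0))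
    {k : ℕ → ℕ} (hkn : ∀ n, k n ≤ n) (hk : Tendsto (fun n : ℕ => (k n : ℝ) / n) atTop (𝓝 1))
    {δ : ℝ} (hδ : 0 < δ) (hak : ∀ᶠ n in atTop, δ ≤ ‖a (k n)‖) :
    Tendsto (fun n : ℕ => empiricalZeroMeasure a n) atTop (𝓝 circleUniform.toFiniteMeasure) := by
  set p : ℕ → Polynomial ℂ := coeffPoly a with hp
  set L : ℕ → ℝ := fun n => Real.log (1 + ∑ j ∈ Finset.range (n + 1), ‖a j‖) with hL
  have hS : ∀ n, 0 ≤ ∑ j ∈ Finset.range (n + 1), ‖a j‖ := fun n =>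
    Finset.sum_nonneg fun _ _ => norm_nonneg _
  have hL0 : ∀ n, 0 ≤ L n := fun n => Real.log_nonneg (by linarith [hS n])
  have hLlim : Tendsto (fun n : ℕ => L n / n) atTop (𝓝 0) := tendsto_log_one_add_sum_div ha
  have hpL : ∀ n (w : ℂ), ‖w‖ = 1 → ‖(p n).eval w‖ ≤ Real.exp (L n) := by
    intro n w hw
    rw [Real.exp_log (by linarith [hS n])]
    exact (norm_eval_coeffPoly_le a n hw).trans (by linarith)
  have hcoeff : ∀ n, (p n).coeff (k n) = a (k n) := fun n => by
    rw [hp, coeff_coeffPoly, if_pos (hkn n)]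
  have hne : ∀ᶠ n in atTop, (p n).coeff (k n) ≠ 0 := by
    filter_upwards [hak] with n hn
    rw [hcoeff, ← norm_pos_iff]
    exact hδ.trans_le hn
  set d : ℕ → ℕ := fun n => (p n).natDegree with hd
  have hdn : ∀ n, d n ≤ n := fun n => natDegree_coeffPoly_le a n
  have hkd : ∀ᶠ n in atTop, k n ≤ d n := by
    filter_upwards [hne] with n hn
    exact Polynomial.le_natDegree_of_ne_zero hn
  have hn0 : ∀ᶠ n : ℕ in atTop, (0 : ℝ) < n := by
    filter_upwards [eventually_gt_atTop 0] with n hn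
    exact_mod_cast hn
  have hdlim : Tendsto (fun n : ℕ => (d n : ℝ) / n) atTop (𝓝 1) := by
    refine tendsto_of_tendsto_of_tendsto_of_le_of_le' hk tendsto_const_nhds ?_ ?_
    · filter_upwards [hkd] with n hn
      gcongr
    · filter_upwards [hn0] with n hn
      rw [div_le_one hn]
      exact_mod_cast hdn n
  have hgap : Tendsto (fun n : ℕ => ((d n - k n : ℕ) : ℝ) / n) atTop (𝓝 0) := by
    have := hdlim.sub hk
    rw [sub_self] at this
    refine this.congr' ?_
    filter_upwards [hkd] with n hn
    rw [Nat.cast_sub hn, sub_div]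
  have hchoose : Tendsto (fun n : ℕ => Real.log ((d n).choose (k n)) / n) atTop (𝓝 0) := by
    refine (tendsto_log_choose_div (d := d) (Eventually.of_forall fun n => Nat.sub_le _ _) hdn
      hgap).congr' ?_
    filter_upwards [hkd] with n hn
    rw [Nat.choose_symm hn]
  have hconst : ∀ c : ℝ, Tendsto (fun n : ℕ => c / n) atTop (𝓝 0) :=
    tendsto_const_div_atTop_nhds_zero_nat
  have hM : Tendsto (fun n : ℕ => (p n).logMahlerMeasure / n) atTop (𝓝 0) := by
    have hlow : Tendsto (fun n : ℕ => Real.log δ / n - Real.log ((d n).choose (k n)) / n) atTop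
        (𝓝 0) := by
      simpa using (hconst (Real.log δ)).sub hchoose
    refine tendsto_of_tendsto_of_tendsto_of_le_of_le' hlow hLlim ?_ ?_
    · filter_upwards [hne, hak] with n h1 h2
      have h3 := log_norm_coeff_le_log_choose_add (p n) h1
      have h4 := Real.log_le_log hδ h2
      rw [hcoeff] at h3
      rw [← sub_div]
      gcongr
      linarith
    · refine Eventually.of_forall fun n => ?_
      gcongr
      exact logMahlerMeasure_le (hL0 n) (hpL n)
  have hcard : Tendsto (fun n : ℕ => (Multiset.card (p n).roots : ℝ) / n) atTop (𝓝 1) := by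
    simpa only [IsAlgClosed.card_roots_eq_natDegree] using hdlim
  have hout : ∀ R : ℝ, 1 < R →
      Tendsto (fun n : ℕ => countOutside R (p n).roots / n) atTop (𝓝 0) := by
    intro R hR
    have hlR := Real.log_pos hR
    have hup : Tendsto (fun n : ℕ => (Real.log ((d n).choose (k n)) / n +
        (p n).logMahlerMeasure / n - Real.log δ / n + ((d n - k n : ℕ) : ℝ) / n * Real.log R) /
        Real.log R) atTop (𝓝 0) := by
      simpa using ((((hchoose.add hM).sub (hconst (Real.log δ))).add
        (hgap.mul_const (Real.log R))).div_const (Real.log R))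
    refine tendsto_of_tendsto_of_tendsto_of_le_of_le' tendsto_const_nhds hup
      (Eventually.of_forall fun n => div_nonneg (countOutside_nonneg _ _) (Nat.cast_nonneg _)) ?_
    filter_upwards [hne, hak, hkd] with n h1 h2 h3
    have h4 := countOutside_mul_log_le (p n) hR h1
    have h5 := Real.log_le_log hδ h2
    rw [hcoeff] at h4
    rw [Nat.cast_sub h3, le_div_iff₀ hlR, div_mul_eq_mul_div, div_mul_eq_mul_div, ← add_div,
      ← sub_div, ← add_div]
    gcongr
    linarith
  -- some fixed coefficient is nonzero, and it controls the roots close to the origin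
  obtain ⟨i, hi⟩ : ∃ i, a i ≠ 0 := by
    obtain ⟨n, hn⟩ := hne.exists
    exact ⟨k n, by rwa [hcoeff] at hn⟩
  have hcoeffi : ∀ᶠ n in atTop, (p n).coeff i = a i := by
    filter_upwards [eventually_ge_atTop i] with n hn
    rw [hp, coeff_coeffPoly, if_pos hn]
  have hchoosei : Tendsto (fun n : ℕ => Real.log ((d n).choose i) / n) atTop (𝓝 0) := by
    refine tendsto_log_choose_div (d := d) (j := fun _ => i) ?_ hdn (hconst i)
    filter_upwards [hcoeffi] with n hn
    exact Polynomial.le_natDegree_of_ne_zero (by rwa [hn])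
  have hin : ∀ R : ℝ, 1 < R →
      Tendsto (fun n : ℕ => countInside R (p n).roots / n) atTop (𝓝 0) := by
    intro R hR
    have hlR := Real.log_pos hR
    have hup : Tendsto (fun n : ℕ => (Real.log ((d n).choose i) / n +
        (p n).logMahlerMeasure / n - Real.log ‖a i‖ / n + (i * Real.log R) / n) /
        Real.log R) atTop (𝓝 0) := by
      simpa using ((((hchoosei.add hM).sub (hconst (Real.log ‖a i‖))).add
        (hconst (i * Real.log R))).div_const (Real.log R))
    refine tendsto_of_tendsto_of_tendsto_of_le_of_le' tendsto_const_nhds hup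
      (Eventually.of_forall fun n => div_nonneg (countInside_nonneg _ _) (Nat.cast_nonneg _)) ?_
    filter_upwards [hcoeffi] with n h1
    have h4 := countInside_mul_log_le (p n) hR (k := i) (by rwa [h1])
    rw [h1] at h4
    rw [le_div_iff₀ hlR, div_mul_eq_mul_div, ← add_div, ← sub_div, ← add_div]
    gcongr
  have hpow : ∀ m : ℕ, m ≠ 0 →
      Tendsto (fun n => multisetAverage (p n).roots n fun z => conjFold z ^ m) atTop (𝓝 0) := by
    intro m hm
    have hup : Tendsto (fun n : ℕ => 2 * m * (2 * (L n / n) - (p n).logMahlerMeasure / n)) atTop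
        (𝓝 0) := by
      simpa using ((hLlim.const_mul 2).sub hM).const_mul (2 * m : ℝ)
    refine squeeze_zero_norm' ?_ hup
    filter_upwards [hne] with n hn
    have hpn : p n ≠ 0 := by
      intro h
      rw [h, Polynomial.coeff_zero] at hn
      exact hn rfl
    rw [multisetAverage, norm_mul, norm_inv, Complex.norm_natCast]
    calc (n : ℝ)⁻¹ * ‖((p n).roots.map fun z => conjFold z ^ m).sum‖
        ≤ (n : ℝ)⁻¹ * (2 * m * (2 * L n - (p n).logMahlerMeasure)) := by
          gcongr
          exact norm_sum_conjFold_pow_le hpn (hL0 n) (hpL n) hm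
      _ = _ := by ring
  rw [FiniteMeasure.tendsto_iff_forall_integral_rclike_tendsto ℂ]
  intro f
  simp only [integral_empiricalZeroMeasure, integral_circleUniform]
  exact tendsto_multisetAverage hcard hin hout hpow f.continuous f.norm_coe_le_norm

end CoeffPoly

/-! ### Consequences of convergence of averages -/

section Frequency

theorem tendsto_div_of_tendsto_sum_div {X : ℕ → ℝ} {c : ℝ}
    (h : Tendsto (fun n : ℕ => (∑ i ∈ Finset.range n, X i) / n) atTop (𝓝 c)) :
    Tendsto (fun n : ℕ => X n / n) atTop (𝓝 0) := by
  have h1 := h.comp (tendsto_add_atTop_nat 1)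
  have h2 : Tendsto (fun n : ℕ => ((n : ℝ) + 1) / n) atTop (𝓝 1) := by
    have := (tendsto_const_div_atTop_nhds_zero_nat (1 : ℝ)).const_add 1
    rw [add_zero] at this
    refine this.congr' ?_
    filter_upwards [eventually_gt_atTop 0] with n hn
    have : (n : ℝ) ≠ 0 := by exact_mod_cast hn.ne'
    field_simp
  have h3 := (h1.mul h2).sub h
  rw [mul_one, sub_self] at h3
  refine h3.congr fun n => ?_
  simp only [Function.comp_apply, Finset.sum_range_succ]
  push_cast
  have : (n : ℝ) + 1 ≠ 0 := by positivity
  field_simp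
  ring

/-- If a set of indices has positive density, then its last element up to `n` is asymptotic
to `n`. -/
theorem tendsto_findGreatest_div {Q : ℕ → Prop} [DecidablePred Q] {c : ℝ} (hc : 0 < c)
    (h : Tendsto (fun n : ℕ => (∑ i ∈ Finset.range n, if Q i then (1 : ℝ) else 0) / n) atTop
      (𝓝 c)) :
    Tendsto (fun n : ℕ => (Nat.findGreatest Q n : ℝ) / n) atTop (𝓝 1) ∧
      ∀ᶠ n in atTop, Q (Nat.findGreatest Q n) := by
  set S : ℕ → ℝ := fun n => ∑ i ∈ Finset.range n, if Q i then (1 : ℝ) else 0 with hS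
  set k : ℕ → ℕ := fun n => Nat.findGreatest Q n with hk
  -- no index between `k n` and `n` is counted, so the ratios `S (n + 1) / (n + 1)` and
  -- `S (k n + 1) / (k n + 1)` have equal numerators and the same limit
  have hSk : ∀ n, S (n + 1) = S (k n + 1) := by
    intro n
    symm
    refine Finset.sum_subset
      (Finset.range_subset_range.2 (Nat.succ_le_succ (Nat.findGreatest_le n))) ?_
    intro i hi hi'
    simp only [Finset.mem_range, not_lt] at hi hi'
    exact if_neg (Nat.findGreatest_is_greatest hi' (Nat.lt_succ_iff.1 hi))
  have hSle : ∀ n : ℕ, S n ≤ n := by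
    intro n
    have := Finset.sum_le_card_nsmul (Finset.range n) (fun i => if Q i then (1 : ℝ) else 0) 1
      fun i _ => by split_ifs <;> norm_num
    simpa only [Finset.card_range, nsmul_eq_mul, mul_one] using this
  have h1 : Tendsto (fun n : ℕ => S (n + 1) / ((n + 1 : ℕ) : ℝ)) atTop (𝓝 c) :=
    h.comp (tendsto_add_atTop_nat 1)
  have hn1 : Tendsto (fun n : ℕ => ((n + 1 : ℕ) : ℝ)) atTop atTop :=
    tendsto_natCast_atTop_atTop.comp (tendsto_add_atTop_nat 1)
  have hStop : Tendsto (fun n : ℕ => S (n + 1)) atTop atTop := by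
    refine (h1.pos_mul_atTop hc hn1).congr fun n => ?_
    have : ((n + 1 : ℕ) : ℝ) ≠ 0 := by positivity
    field_simp
  have hktop' : Tendsto (fun n => ((k n + 1 : ℕ) : ℝ)) atTop atTop :=
    tendsto_atTop_mono (fun n => (hSk n).trans_le (hSle _)) hStop
  have hktop : Tendsto (fun n => k n + 1) atTop atTop := tendsto_natCast_atTop_iff.1 hktop'
  have h2 : Tendsto (fun n : ℕ => S (k n + 1) / ((k n + 1 : ℕ) : ℝ)) atTop (𝓝 c) := h.comp hktop
  have h3 : Tendsto (fun n : ℕ => ((k n + 1 : ℕ) : ℝ) / ((n + 1 : ℕ) : ℝ)) atTop (𝓝 1) := by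
    have := h1.div h2 hc.ne'
    rw [div_self hc.ne'] at this
    refine this.congr' ?_
    filter_upwards [hStop.eventually_gt_atTop 0] with n hn
    simp only [Pi.div_apply]
    rw [← hSk]
    have : ((n + 1 : ℕ) : ℝ) ≠ 0 := by positivity
    have : ((k n + 1 : ℕ) : ℝ) ≠ 0 := by positivity
    field_simp
  refine ⟨?_, ?_⟩
  · have h4 : Tendsto (fun n : ℕ => (1 : ℝ) / n) atTop (𝓝 0) :=
      tendsto_const_div_atTop_nhds_zero_nat 1
    have h5 := (h3.mul (h4.const_add 1)).sub h4
    rw [add_zero, mul_one, sub_zero] at h5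
    refine h5.congr' ?_
    filter_upwards [eventually_gt_atTop 0] with n hn
    have : (n : ℝ) ≠ 0 := by exact_mod_cast hn.ne'
    push_cast
    have : (n : ℝ) + 1 ≠ 0 := by positivity
    field_simp
    ring
  · filter_upwards [hktop.eventually_gt_atTop 1] with n hn
    exact Nat.findGreatest_of_ne_zero rfl (by omega : k n ≠ 0)

end Frequency

/-! ### Independent identically distributed coefficients -/

theorem theorem2 {Ω : Type*} [MeasurableSpace Ω] (P : Measure Ω) [IsProbabilityMeasure P]
    (ξ : ℕ → Ω → ℂ) (hmeas : ∀ k, Measurable (ξ k))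
    (hindep : iIndepFun ξ P) (hident : ∀ k, IdentDistrib (ξ k) (ξ 0) P P)
    (hnondeg : P {ω | ξ 0 ω = 0} < 1)
    (hlog : Integrable (fun ω => Real.log (1 + ‖ξ 0 ω‖)) P) :
    ∀ᵐ ω ∂P, Tendsto (fun n : ℕ => empiricalZeroMeasure (fun k => ξ k ω) n) atTop
      (𝓝 circleUniform.toFiniteMeasure) := by
  classical
  -- a threshold exceeded by `‖ξ 0‖` with positive probability
  obtain ⟨δ, hδ, hpos⟩ : ∃ δ : ℝ, 0 < δ ∧ 0 < P {ω | δ ≤ ‖ξ 0 ω‖} := by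
    by_contra! hcon
    have h1 : ∀ n : ℕ, ∀ᵐ ω ∂P, ‖ξ 0 ω‖ < 1 / ((n : ℝ) + 1) := by
      intro n
      have := nonpos_iff_eq_zero.1 (hcon (1 / ((n : ℝ) + 1)) (by positivity))
      rw [ae_iff]
      simpa only [not_lt] using this
    have h2 : ∀ᵐ ω ∂P, ξ 0 ω = 0 := by
      filter_upwards [ae_all_iff.2 h1] with ω hω
      rw [← norm_le_zero_iff]
      exact ge_of_tendsto' tendsto_one_div_add_atTop_nhds_zero_nat fun n => (hω n).le
    have h3 : P {ω | ξ 0 ω = 0} = P Set.univ := measure_congr (eventuallyEq_univ.2 h2)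
    rw [h3, measure_univ] at hnondeg
    exact lt_irrefl _ hnondeg
  let φ : ℂ → ℝ := fun z => Real.log (1 + ‖z‖)
  let ψ : ℂ → ℝ := fun z => if δ ≤ ‖z‖ then 1 else 0
  have hφ : Measurable φ := by fun_prop
  have hψ : Measurable ψ :=
    Measurable.ite (measurableSet_le measurable_const measurable_norm) measurable_const
      measurable_const
  have hlawφ := strong_law_ae_real (fun k => φ ∘ ξ k) hlog
    (fun i j hij => (hindep.indepFun hij).comp hφ hφ) fun i => (hident i).comp hφ
  have hψint : Integrable (ψ ∘ ξ 0) P := by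
    refine Integrable.of_bound (hψ.comp (hmeas 0)).aestronglyMeasurable 1
      (Eventually.of_forall fun ω => ?_)
    simp only [ψ, Function.comp_apply]
    split_ifs <;> simp
  have hlawψ := strong_law_ae_real (fun k => ψ ∘ ξ k) hψint
    (fun i j hij => (hindep.indepFun hij).comp hψ hψ) fun i => (hident i).comp hψ
  have hmean : 0 < ∫ ω, (ψ ∘ ξ 0) ω ∂P := by
    have hset : MeasurableSet {ω | δ ≤ ‖ξ 0 ω‖} :=
      measurableSet_le measurable_const (hmeas 0).norm
    have e : ψ ∘ ξ 0 = {ω | δ ≤ ‖ξ 0 ω‖}.indicator fun _ => (1 : ℝ) := by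
      ext ω
      simp [ψ, Set.indicator_apply]
    rw [e, integral_indicator_const _ hset, smul_eq_mul, mul_one]
    exact ENNReal.toReal_pos hpos.ne' (measure_ne_top _ _)
  filter_upwards [hlawφ, hlawψ] with ω h1 h2
  obtain ⟨h3, h4⟩ := tendsto_findGreatest_div (Q := fun i => δ ≤ ‖ξ i ω‖) hmean h2
  exact tendsto_empiricalZeroMeasure (tendsto_div_of_tendsto_sum_div h1)
    (fun n => Nat.findGreatest_le n) h3 hδ h4
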